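/- Let $N\ge 1$, let $\Omega\subset\mathbb R^N$ be a bounded open set, let $p>1$, and let $\psi:\mathbb R\to\mathbb R$ be nondecreasing, continuous, unbounded and odd, with $c_1s^{p-1}\le\psi(s)\le c_2s^{p-1}$ for all $s>0$ and some constants $c_1,c_2>0$. Put $\Psi(s)=\int_0^s\psi(t)\,dt$. Let $J:\mathbb R^N\setminus\{0\}\to(0,\infty)$ be measurable with $J(z)=J(-z)$, $J\notin L^1(B_1)$ and $\int_{\mathbb R^N}\min(1,|z|^{q_0})J(z)\,dz<\infty$ for some $q_0>0$, and assume that for some $\alpha>0$ and $c>0$ $$J(z)\ge c|z|^{-N-\alpha}\qquad\text{for } 0<|z|<1.$$ Let $W_0^{J,\Psi}(\Omega)$ be the set of measurable $u:\mathbb R^N\to\mathbb R$ with $u=0$ a.e. in $\mathbb R^N\setminus\Omega$, $\int_{\mathbb R^N}\Psi(u(x))\,dx<\infty$ and $\iint_{\mathbb R^{2N}}\Psi(u(x)-u(y))J(x-y)\,dx\,dy<\infty$. A weak solution of $$\mathcal L u=f\ \text{ in }\Omega,\qquad u=0\ \text{ in }\mathbb R^N\setminus\Omega,\qquad\text{where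 } \mathcal Lu(x)=\int_{\mathbb R^N}\psi(u(x)-u(y))J(x-y)\,dy,$$ is a function $u\in W_0^{J,\Psi}(\Omega)$ such that for every $\varphi\in W_0^{J,\Psi}(\Omega)$ the product $f\varphi$ is integrable on $\Omega$ and $$\frac12\iint_{\mathbb R^{2N}}\psi(u(x)-u(y))\,(\varphi(x)-\varphi(y))\,J(x-y)\,dx\,dy=\int_\Omega f\varphi\,dx .$$ **Theorem.** If $u$ is a weak solution of this problem with $f\in L^m(\Omega)$, $0<m<N/\alpha$, then $u\in L^{r}(\Omega)$ with $$r=\frac{m(p-1)N}{N-m\alpha}.$$ (For $0<s<1$, $L^s(\Omega)$ is the set of measurable $g$ with $\int_\Omega|g|^s<\infty$.) -/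

import Mathlib

open MeasureTheory

noncomputable section

namespace NonlocalOrlicz

/-- Euclidean space of dimension `N`. -/
abbrev RN (N : ℕ) : Type := EuclideanSpace ℝ (Fin N)

/-- The standing assumptions on the nonlinearity: nondecreasing, continuous, unbounded and odd. -/
structure IsNonlinearity (ψ : ℝ → ℝ) : Prop where
  monotone : Monotone ψ
  continuous : Continuous ψ
  unbounded : ∀ M : ℝ, ∃ s : ℝ, M < ψ s
  odd : ∀ s : ℝ, ψ (-s) = -ψ s

/-- The standing assumptions on the kernel. The value at the origin, where a singular kernel has
no finite value, is irrelevant and left free. -/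
structure IsKernel {N : ℕ} (J : RN N → ℝ) : Prop where
  measurable : Measurable J
  pos : ∀ z, z ≠ 0 → 0 < J z
  even : ∀ z, J (-z) = J z
  not_integrable : ¬ IntegrableOn J (Metric.ball 0 1)
  moment : ∃ q₀ : ℝ, 0 < q₀ ∧ Integrable (fun z => min 1 (‖z‖ ^ q₀) * J z)

/-- `ψ` is power-like with exponent `p - 1`. -/
def IsPowerLike (ψ : ℝ → ℝ) (p : ℝ) : Prop :=
  ∃ c₁ c₂ : ℝ, 0 < c₁ ∧ 0 < c₂ ∧
    ∀ s : ℝ, 0 < s → c₁ * s ^ (p - 1) ≤ ψ s ∧ ψ s ≤ c₂ * s ^ (p - 1)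

/-- The singularity condition `J(z) ≥ c |z|^{-N-α}` for `0 < |z| < 1`, with some `c > 0`. -/
def HasSingularity {N : ℕ} (J : RN N → ℝ) (α : ℝ) : Prop :=
  ∃ c : ℝ, 0 < c ∧ ∀ z, 0 < ‖z‖ → ‖z‖ < 1 → c * ‖z‖ ^ (-(N : ℝ) - α) ≤ J z

/-- The primitive `Ψ` of `ψ` vanishing at `0`. -/
def primitive (ψ : ℝ → ℝ) (s : ℝ) : ℝ := ∫ t in (0 : ℝ)..s, ψ t

/-- The functional `F(u) = ∫ Ψ(u(x)) dx`, with values in `[0, ∞]`. -/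
def modular {N : ℕ} (ψ : ℝ → ℝ) (u : RN N → ℝ) : ENNReal :=
  ∫⁻ x, ENNReal.ofReal (primitive ψ (u x))

/-- The functional `E(u) = (1/2) ∬ Ψ(u(x) - u(y)) J(x - y) dx dy`, with values in `[0, ∞]`. -/
def energy {N : ℕ} (J : RN N → ℝ) (ψ : ℝ → ℝ) (u : RN N → ℝ) : ENNReal :=
  2⁻¹ * ∫⁻ z : RN N × RN N, ENNReal.ofReal (primitive ψ (u z.1 - u z.2) * J (z.1 - z.2))

/-- The interaction energy
`𝓔(u; φ) = (1/2) ∬ ψ(u(x) - u(y)) (φ(x) - φ(y)) J(x - y) dx dy`. -/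
def interaction {N : ℕ} (J : RN N → ℝ) (ψ : ℝ → ℝ) (u φ : RN N → ℝ) : ℝ :=
  2⁻¹ * ∫ z : RN N × RN N, ψ (u z.1 - u z.2) * (φ z.1 - φ z.2) * J (z.1 - z.2)

/-- Membership in `W^{J,Ψ}(ℝ^N)`. -/
structure MemW {N : ℕ} (J : RN N → ℝ) (ψ : ℝ → ℝ) (u : RN N → ℝ) : Prop where
  aestronglyMeasurable : AEStronglyMeasurable u
  modular_lt_top : modular ψ u < ⊤
  energy_lt_top : energy J ψ u < ⊤

/-- Membership in `W_0^{J,Ψ}(Ω)`: functions in `W^{J,Ψ}(ℝ^N)` vanishing (almost everywhere)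
outside `Ω`. -/
structure MemW0 {N : ℕ} (J : RN N → ℝ) (ψ : ℝ → ℝ) (Ω : Set (RN N)) (u : RN N → ℝ) : Prop where
  memW : MemW J ψ u
  eq_zero : ∀ᵐ x, x ∉ Ω → u x = 0

/-- `u` is a weak solution of `𝓛u = f` in `Ω`, `u = 0` outside `Ω`: it lies in `W_0^{J,Ψ}(Ω)`, and
for every test function `φ` in the same space `∫_Ω f φ` makes sense and equals `𝓔(u; φ)`. -/
structure IsWeakSolution {N : ℕ} (J : RN N → ℝ) (ψ : ℝ → ℝ) (Ω : Set (RN N)) (f u : RN N → ℝ) :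
    Prop where
  memW0 : MemW0 J ψ Ω u
  integrableOn : ∀ φ : RN N → ℝ, MemW0 J ψ Ω φ → IntegrableOn (fun x => f x * φ x) Ω
  weak_eq : ∀ φ : RN N → ℝ, MemW0 J ψ Ω φ → interaction J ψ u φ = ∫ x in Ω, f x * φ x

end NonlocalOrlicz

end

/-!
The proof is an a priori estimate obtained by testing with truncated powers of `u`, in a form that
avoids Sobolev spaces. Write `σ = α / N`, `q = 1 / (1 - σ) = N / (N - α)` when `α < N`, and `m'` for
the exponent conjugate to `m`.

The singularity of `J`, together with its positivity far from the origin (which replaces a Poincaré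
inequality, as `Ω` is bounded), shows that `J(x - ·)` has mass at least `C V ^ (-σ)` off any subset
of `Ω` of measure `V` (`exists_le_setLIntegral_kernel`). Combined with Chebyshev's inequality for the
level sets `{|v| > |v(x)| / 2}`, this gives the Sobolev type inequality
`c (∫ Θ(|v|) ^ q) ^ (1 - σ) ≤ ∬ F(v(x), v(y)) J(x - y)` as soon as `F(a, b) ≥ Θ(|a|)` for
`|b| ≤ |a| / 2` and the integral on the left is finite (`level_set_sobolev`).

With `F(a, b) = |a - b| ^ p`, applied to truncations of `u`, it yields `u ∈ L^(p q)`
(`lintegral_sobolev_lt_top`). Since the singularity condition for `α` implies it for smaller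
exponents, this settles the cases `r ≤ p q` and `α ≥ N`.

Otherwise `m > 1`, and there is `b ≥ 0` with `(p + b) q = (1 + b) m' = r`. The test function
`G(u) = u min(|u|, k) ^ b` is admissible because `G` is Lipschitz, and
`F(a, s) = ψ(a - s) (G(a) - G(s))` dominates a multiple of `Θ(|a|) = |a| ^ p min(|a|, k) ^ b`
(`le_mul_truncPow_sub`). Since `|G| ^ m' ≤ Θ ^ q` (`mul_rpow_rpow_le`), the quantity
`X = ∫ Θ(|u|) ^ q`, which is finite by the Sobolev step, satisfies
`X ^ (1 - σ) ≤ C ‖f‖_m X ^ (1 / m')`. As `1 / m' < 1 - σ` is exactly `m < N / α`, this bounds `X`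
independently of `k`, and Fatou's lemma gives the claim (`lintegral_lt_top_of_test`).
-/

namespace NonlocalOrlicz

open Filter Set

/-! ### Integrals -/

lemma lintegral_le_of_eventually_eq {X : Type*} [MeasurableSpace X] {μ : Measure X}
    {g : ℕ → X → ENNReal} {h : X → ENNReal} {M : ENNReal} (hg : ∀ k, AEMeasurable (g k) μ)
    (hev : ∀ x, ∀ᶠ k in atTop, g k x = h x) (hM : ∀ k, ∫⁻ x, g k x ∂μ ≤ M) :
    ∫⁻ x, h x ∂μ ≤ M := by
  have hlim : ∀ x, liminf (fun k => g k x) atTop = h x := fun x =>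
    (tendsto_const_nhds.congr' ((hev x).mono fun _ hk => hk.symm)).liminf_eq
  calc ∫⁻ x, h x ∂μ = ∫⁻ x, liminf (fun k => g k x) atTop ∂μ := by simp_rw [hlim]
    _ ≤ liminf (fun k => ∫⁻ x, g k x ∂μ) atTop := lintegral_liminf_le' hg
    _ ≤ M := liminf_le_of_frequently_le' (Frequently.of_forall hM)

lemma memLp_of_lintegral_abs_rpow_lt_top {X : Type*} [MeasurableSpace X] {μ : Measure X}
    {u : X → ℝ} {r : ℝ} (hr : 0 < r) (hu : AEStronglyMeasurable u μ)
    (h : ∫⁻ x, ENNReal.ofReal (|u x| ^ r) ∂μ < ⊤) : MemLp u (ENNReal.ofReal r) μ := by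
  refine ⟨hu, ?_⟩
  rw [eLpNorm_lt_top_iff_lintegral_rpow_enorm_lt_top (by simpa using hr) ENNReal.ofReal_ne_top,
    ENNReal.toReal_ofReal hr.le]
  refine lt_of_eq_of_lt (lintegral_congr fun x => ?_) h
  rw [← ofReal_norm, Real.norm_eq_abs,
    ENNReal.ofReal_rpow_of_nonneg (abs_nonneg _) hr.le]

/-- An inequality `c X ^ a ≤ B X ^ b` with `b < a` bounds `X`, as soon as `X` is finite. -/
lemma le_of_mul_rpow_le_mul_rpow {X B : ENNReal} {c a b : ℝ} (hc : 0 < c) (hX : X ≠ ⊤)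
    (hb : 0 ≤ b) (hab : b < a) (h : ENNReal.ofReal c * X ^ a ≤ B * X ^ b) :
    X ≤ (B / ENNReal.ofReal c) ^ (1 / (a - b)) := by
  rcases eq_or_ne X 0 with rfl | hX0
  · exact zero_le
  have hd : 0 < a - b := sub_pos.2 hab
  have hXb0 : X ^ b ≠ 0 := by simp [ENNReal.rpow_eq_zero_iff, hX0, hX]
  have hXb : X ^ b ≠ ⊤ := ENNReal.rpow_ne_top_of_nonneg hb hX
  have h1 : X ^ a = X ^ (a - b) * X ^ b := by
    rw [← ENNReal.rpow_add _ _ hX0 hX, sub_add_cancel]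
  rw [h1, ← mul_assoc, ENNReal.mul_le_mul_iff_left hXb0 hXb] at h
  have h2 : X ^ (a - b) ≤ B / ENNReal.ofReal c := by
    rw [ENNReal.le_div_iff_mul_le (Or.inl (by simpa using hc)) (Or.inl ENNReal.ofReal_ne_top),
      mul_comm]
    exact h
  calc X = (X ^ (a - b)) ^ (1 / (a - b)) := by
        rw [← ENNReal.rpow_mul, mul_one_div_cancel hd.ne', ENNReal.rpow_one]
    _ ≤ _ := ENNReal.rpow_le_rpow h2 (by positivity)

/-! ### Lower bounds for the mass of the kernel -/

/-- Points of a bounded set see a uniformly positive amount of the kernel outside the set. -/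
lemma exists_le_lintegral_compl {N : ℕ} (hN : N ≠ 0) {Ω : Set (RN N)}
    (hΩ : Bornology.IsBounded Ω) (hΩm : MeasurableSet Ω) {J : RN N → ℝ} (hJ : IsKernel J) :
    ∃ κ : ℝ, 0 < κ ∧ ∀ x ∈ Ω,
      ENNReal.ofReal κ ≤ ∫⁻ y in Ωᶜ, ENNReal.ofReal (J (x - y)) := by
  have : NeZero N := ⟨hN⟩
  obtain ⟨R, hR0, hR⟩ := hΩ.subset_ball_lt 0 0
  set T : Set (RN N) := {z | 2 * R < ‖z‖} with hT
  have hTo : IsOpen T := isOpen_lt continuous_const continuous_norm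
  obtain ⟨z₀, hz₀⟩ := NormedSpace.exists_lt_norm ℝ (RN N) (2 * R)
  have hTpos : 0 < volume T := hTo.measure_pos volume ⟨z₀, hz₀⟩
  have hJm : Measurable fun z => ENNReal.ofReal (J z) := hJ.measurable.ennreal_ofReal
  set K := ∫⁻ z in T, ENNReal.ofReal (J z) with hK
  have hKpos : 0 < K := by
    rw [hK, setLIntegral_pos_iff hJm]
    refine lt_of_lt_of_le hTpos (measure_mono fun z hz => ⟨?_, hz⟩)
    have hz' : 2 * R < ‖z‖ := hz
    have hz0 : z ≠ 0 := norm_pos_iff.1 (by linarith)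
    simpa using hJ.pos z hz0
  have hmin : min K 1 ≠ ⊤ := (lt_of_le_of_lt (min_le_right _ _) ENNReal.one_lt_top).ne
  refine ⟨(min K 1).toReal, ENNReal.toReal_pos (lt_min hKpos one_pos).ne' hmin, fun x hx => ?_⟩
  rw [ENNReal.ofReal_toReal hmin]
  refine (min_le_left _ _).trans ?_
  rw [hK, ← lintegral_indicator hTo.measurableSet, ← lintegral_indicator hΩm.compl,
    ← lintegral_sub_left_eq_self _ x]
  refine lintegral_mono fun y => ?_
  by_cases hy : x - y ∈ T
  · have hyΩ : y ∈ Ωᶜ := by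
      intro hyΩ
      have h1 := hR hx
      have h2 := hR hyΩ
      rw [mem_ball_zero_iff] at h1 h2
      have h3 : 2 * R < ‖x - y‖ := hy
      linarith [norm_sub_le x y]
    simp [indicator_of_mem hy, indicator_of_mem hyΩ]
  · simp [indicator_of_notMem hy]

/-- If the complement of `S` has measure at most `V`, the kernel centred at a point of `Ω` has
mass at least `C V ^ (-α / N)` on `S`: for small `V` because `S` covers half of a ball of volume
`2 V` on which the kernel is at least a multiple of `V ^ (-1 - α / N)`, for large `V` because `S`
contains the exterior of `Ω`. -/
lemma exists_le_setLIntegral_kernel {N : ℕ} (hN : N ≠ 0) {Ω : Set (RN N)}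
    (hΩ : Bornology.IsBounded Ω) (hΩm : MeasurableSet Ω) {J : RN N → ℝ} (hJ : IsKernel J)
    {α : ℝ} (hα : 0 < α) (hJα : HasSingularity J α) :
    ∃ C : ℝ, 0 < C ∧ ∀ V : ℝ, 0 < V → ∀ x ∈ Ω, ∀ S : Set (RN N), NullMeasurableSet S →
      (∀ᵐ y, y ∉ Ω → y ∈ S) → volume Sᶜ ≤ ENNReal.ofReal V →
      ENNReal.ofReal (C * V ^ (-(α / N))) ≤ ∫⁻ y in S, ENNReal.ofReal (J (x - y)) := by
  have : NeZero N := ⟨hN⟩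
  have hN0 : (0 : ℝ) < N := by exact_mod_cast Nat.pos_of_ne_zero hN
  obtain ⟨κ, hκ, hκΩ⟩ := exists_le_lintegral_compl hN hΩ hΩm hJ
  obtain ⟨c, hc, hcJ⟩ := hJα
  set ω : ℝ := (volume (Metric.ball (0 : RN N) 1)).toReal with hω
  have hωtop : volume (Metric.ball (0 : RN N) 1) ≠ ⊤ := measure_ball_lt_top.ne
  have hω0 : 0 < ω := ENNReal.toReal_pos (Metric.measure_ball_pos _ _ one_pos).ne' hωtop
  have hvol : ∀ (x : RN N) (r : ℝ), 0 ≤ r →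
      volume (Metric.ball x r) = ENNReal.ofReal (r ^ N * ω) := fun x r hr => by
    rw [Measure.addHaar_ball _ _ hr, ENNReal.ofReal_mul (by positivity), hω,
      ENNReal.ofReal_toReal hωtop, finrank_euclideanSpace, Fintype.card_fin]
  set σ := α / N with hσ
  have hσ0 : 0 < σ := div_pos hα hN0
  set C₁ : ℝ := c * (2 / ω) ^ (-1 - σ) with hC₁
  set C₂ : ℝ := κ * (ω / 2) ^ σ with hC₂
  have hC₁0 : 0 < C₁ := by positivity
  have hC₂0 : 0 < C₂ := by positivity
  refine ⟨min C₁ C₂, lt_min hC₁0 hC₂0, fun V hV x hx S hS hΩS hSV => ?_⟩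
  rcases lt_or_ge V (ω / 2) with hVω | hVω
  -- `r` is the radius, less than `1`, of a ball of volume `2 V`
  · set r : ℝ := (2 * V / ω) ^ (1 / (N : ℝ)) with hr
    have hbase : 0 < 2 * V / ω := by positivity
    have hr0 : 0 < r := Real.rpow_pos_of_pos hbase _
    have hr1 : r < 1 := Real.rpow_lt_one hbase.le (by rw [div_lt_one hω0]; linarith)
      (by positivity)
    have hrN : r ^ N = 2 * V / ω := by
      rw [hr, ← Real.rpow_natCast, ← Real.rpow_mul hbase.le, one_div_mul_cancel hN0.ne',
        Real.rpow_one]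
    have hrα : r ^ (-(N : ℝ) - α) = (2 * V / ω) ^ (-1 - σ) := by
      rw [hr, ← Real.rpow_mul hbase.le, hσ]
      congr 1
      field_simp
    have hball : volume (Metric.ball x r) = ENNReal.ofReal V + ENNReal.ofReal V := by
      rw [hvol x r hr0.le, hrN, ← ENNReal.ofReal_add hV.le hV.le]
      congr 1
      field_simp
      ring
    have hmeas : ENNReal.ofReal V ≤ volume (S ∩ (Metric.ball x r \ {x})) := by
      have h1 : volume (Metric.ball x r) ≤
          volume (S ∩ (Metric.ball x r \ {x})) + ENNReal.ofReal V := by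
        calc volume (Metric.ball x r)
            ≤ volume ((S ∩ (Metric.ball x r \ {x})) ∪ (Sᶜ ∪ {x})) := by
              refine measure_mono fun y hy => ?_
              simp only [mem_union, mem_inter_iff, Set.mem_sdiff, mem_singleton_iff, mem_compl_iff]
              tauto
          _ ≤ volume (S ∩ (Metric.ball x r \ {x})) + (volume Sᶜ + volume {x}) :=
              (measure_union_le _ _).trans (by gcongr; exact measure_union_le _ _)
          _ ≤ _ := by
              rw [measure_singleton, add_zero]
              gcongr
      rw [hball] at h1
      exact (ENNReal.add_le_add_iff_right ENNReal.ofReal_ne_top).1 h1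
    have hnm : NullMeasurableSet (S ∩ (Metric.ball x r \ {x})) :=
      hS.inter (Metric.isOpen_ball.measurableSet.diff (measurableSet_singleton x)).nullMeasurableSet
    calc ENNReal.ofReal (min C₁ C₂ * V ^ (-σ))
        ≤ ENNReal.ofReal (c * r ^ (-(N : ℝ) - α) * V) := by
          apply ENNReal.ofReal_le_ofReal
          have h2 : c * r ^ (-(N : ℝ) - α) * V = C₁ * V ^ (-σ) := by
            rw [hrα, hC₁, show 2 * V / ω = (2 / ω) * V by ring,
              Real.mul_rpow (by positivity) hV.le,
              show -σ = (-1 - σ) + 1 by ring, Real.rpow_add hV (-1 - σ) 1, Real.rpow_one]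
            ring
          rw [h2]
          gcongr
          exact min_le_left _ _
      _ = ENNReal.ofReal (c * r ^ (-(N : ℝ) - α)) * ENNReal.ofReal V :=
          ENNReal.ofReal_mul (by positivity)
      _ ≤ ENNReal.ofReal (c * r ^ (-(N : ℝ) - α)) *
            volume (S ∩ (Metric.ball x r \ {x})) := by gcongr
      _ = ∫⁻ _ in S ∩ (Metric.ball x r \ {x}), ENNReal.ofReal (c * r ^ (-(N : ℝ) - α)) := by
          rw [setLIntegral_const]
      _ ≤ ∫⁻ y in S ∩ (Metric.ball x r \ {x}), ENNReal.ofReal (J (x - y)) := by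
          refine lintegral_mono_ae ((ae_restrict_iff'₀ hnm).2 (ae_of_all _ fun y hy => ?_))
          apply ENNReal.ofReal_le_ofReal
          have hy0 : 0 < ‖x - y‖ := norm_pos_iff.2 (sub_ne_zero.2 fun h => hy.2.2 h.symm)
          have hyr : ‖x - y‖ < r := by
            rw [← dist_eq_norm, dist_comm]; exact hy.2.1
          refine le_trans ?_ (hcJ _ hy0 (hyr.trans hr1))
          gcongr 1
          exact Real.rpow_le_rpow_of_nonpos hy0 hyr.le (by linarith)
      _ ≤ ∫⁻ y in S, ENNReal.ofReal (J (x - y)) := lintegral_mono_set inter_subset_left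
  · calc ENNReal.ofReal (min C₁ C₂ * V ^ (-σ)) ≤ ENNReal.ofReal κ := by
          apply ENNReal.ofReal_le_ofReal
          calc min C₁ C₂ * V ^ (-σ) ≤ C₂ * (ω / 2) ^ (-σ) := by
                gcongr ?_ * ?_
                · exact min_le_right _ _
                · exact Real.rpow_le_rpow_of_nonpos (by positivity) hVω (by linarith)
            _ = κ := by
                rw [hC₂, mul_assoc, ← Real.rpow_add (by positivity)]; simp
      _ ≤ ∫⁻ y in Ωᶜ, ENNReal.ofReal (J (x - y)) := hκΩ x hx
      _ ≤ ∫⁻ y in S, ENNReal.ofReal (J (x - y)) :=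
          lintegral_mono' (Measure.restrict_mono_ae (hΩS.mono fun y hy h => hy h)) le_rfl

/-! ### A Sobolev inequality by level sets -/

/-- For every `x ∈ Ω` the function `J(x - ·)` has mass at least `C V ^ (-σ)` on the complement of
any subset of `Ω` of measure at most `V`. The complement `S` itself is the variable, and the
inclusion of its complement in `Ω` is required up to a null set. -/
def KernelMassBound {N : ℕ} (J : RN N → ℝ) (Ω : Set (RN N)) (C σ : ℝ) : Prop :=
  ∀ V : ℝ, 0 < V → ∀ x ∈ Ω, ∀ S : Set (RN N), NullMeasurableSet S →
    (∀ᵐ y, y ∉ Ω → y ∈ S) → volume Sᶜ ≤ ENNReal.ofReal V →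
    ENNReal.ofReal (C * V ^ (-σ)) ≤ ∫⁻ y in S, ENNReal.ofReal (J (x - y))

/-- Let `Θ` be nondecreasing and doubling, and let `F(a, b) ≥ Θ(|a|)` whenever `|b| ≤ |a| / 2`.
Then `∫ Θ(|v|) ^ q`, `q = 1 / (1 - σ)`, is controlled by the double integral of
`F(v(x), v(y)) J(x - y)`. Indeed at a point with `|v(x)| = t` it suffices to integrate over `y` with
`|v(y)| ≤ t / 2`; by Chebyshev's inequality the exceptional set has measure at most a multiple of
`Θ(t) ^ (-q) ∫ Θ(|v|) ^ q`, so the inner integral is at least a multiple of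
`Θ(t) ^ (1 + q σ) (∫ Θ(|v|) ^ q) ^ (-σ)`, and `1 + q σ = q`. -/
theorem level_set_sobolev {N : ℕ} {Ω : Set (RN N)} {J : RN N → ℝ} {C σ : ℝ} (hC : 0 < C)
    (hσ1 : σ < 1) (hJ : KernelMassBound J Ω C σ) {v : RN N → ℝ} (hv : AEMeasurable v)
    (hvΩ : ∀ᵐ x, x ∉ Ω → v x = 0) {Θ : ℝ → ℝ} (hΘm : MonotoneOn Θ (Ici 0)) (hΘ0 : Θ 0 = 0)
    (hΘpos : ∀ t, 0 < t → 0 < Θ t) {D : ℝ} (hD : 0 < D) (hΘD : ∀ t, 0 < t → Θ t ≤ D * Θ (t / 2))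
    {F : ℝ → ℝ → ℝ} (hF : ∀ a b, a ≠ 0 → |b| ≤ |a| / 2 → Θ |a| ≤ F a b)
    (hfin : ∫⁻ x, ENNReal.ofReal (Θ |v x| ^ (1 / (1 - σ))) ≠ ⊤) :
    ENNReal.ofReal (C * D ^ (-(1 / (1 - σ) * σ))) *
        (∫⁻ x, ENNReal.ofReal (Θ |v x| ^ (1 / (1 - σ)))) ^ (1 - σ) ≤
      ∫⁻ x, ∫⁻ y, ENNReal.ofReal (F (v x) (v y) * J (x - y)) := by
  have hσ1' : 0 < 1 - σ := sub_pos.2 hσ1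
  set q := 1 / (1 - σ) with hq
  have hq0 : 0 < q := by positivity
  have hqσ : 1 + q * σ = q := by rw [hq]; field_simp; ring
  set X := ∫⁻ x, ENNReal.ofReal (Θ |v x| ^ q) with hX
  rcases eq_or_ne X 0 with h0 | h0
  · rw [h0, ENNReal.zero_rpow_of_pos hσ1', mul_zero]; exact zero_le
  set X₀ := X.toReal with hX₀
  have hX₀pos : 0 < X₀ := ENNReal.toReal_pos h0 hfin
  have hXeq : X = ENNReal.ofReal X₀ := (ENNReal.ofReal_toReal hfin).symm
  have hΘnn : ∀ t, 0 ≤ t → 0 ≤ Θ t := fun t ht => hΘ0 ▸ hΘm self_mem_Ici ht ht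
  set c : ℝ := C * D ^ (-(q * σ)) * X₀ ^ (-σ) with hc
  have hc0 : 0 < c := by positivity
  have key : ∀ᵐ x, ENNReal.ofReal c * ENNReal.ofReal (Θ |v x| ^ q) ≤
      ∫⁻ y, ENNReal.ofReal (F (v x) (v y) * J (x - y)) := by
    filter_upwards [hvΩ] with x hx
    rcases eq_or_ne (v x) 0 with hvx | hvx
    · simp [hvx, hΘ0, Real.zero_rpow hq0.ne']
    have hxΩ : x ∈ Ω := by by_contra h; exact hvx (hx h)
    set t := |v x| with ht
    have ht0 : 0 < t := abs_pos.2 hvx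
    have hΘt := hΘpos t ht0
    have hΘt2 := hΘpos (t / 2) (by positivity)
    set S : Set (RN N) := {y | |v y| ≤ t / 2} with hS
    have hSm : NullMeasurableSet S := by
      have : AEMeasurable fun y => |v y| := continuous_abs.measurable.comp_aemeasurable hv
      exact nullMeasurableSet_le this aemeasurable_const
    set V := X₀ * (D / Θ t) ^ q with hV
    have hV0 : 0 < V := by positivity
    have hSV : volume Sᶜ ≤ ENNReal.ofReal V := by
      set ε := ENNReal.ofReal (Θ (t / 2) ^ q) with hε
      have hε0 : ε ≠ 0 := by
        simpa [hε] using Real.rpow_pos_of_pos hΘt2 q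
      have h1 : ε * volume Sᶜ ≤ X := by
        calc ε * volume Sᶜ = ∫⁻ _ in Sᶜ, ε := by rw [setLIntegral_const]
          _ ≤ ∫⁻ y in Sᶜ, ENNReal.ofReal (Θ |v y| ^ q) := by
              refine lintegral_mono_ae ((ae_restrict_iff'₀ hSm.compl).2
                (ae_of_all _ fun y hy => ENNReal.ofReal_le_ofReal ?_))
              have hy' : t / 2 < |v y| := not_le.1 hy
              exact Real.rpow_le_rpow hΘt2.le
                (hΘm (by positivity : (0 : ℝ) ≤ t / 2) (abs_nonneg (v y)) hy'.le) hq0.le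
          _ ≤ X := setLIntegral_le_lintegral _ _
      have h2 : volume Sᶜ ≤ X / ε := by
        rw [ENNReal.le_div_iff_mul_le (Or.inl hε0) (Or.inl ENNReal.ofReal_ne_top), mul_comm]
        exact h1
      refine h2.trans ?_
      rw [hXeq, hε, ← ENNReal.ofReal_div_of_pos (by positivity)]
      apply ENNReal.ofReal_le_ofReal
      rw [hV, div_eq_mul_inv, ← Real.inv_rpow hΘt2.le]
      gcongr
      rw [inv_eq_one_div, div_le_div_iff₀ hΘt2 hΘt]
      linarith [hΘD t ht0]
    have hmass := hJ V hV0 x hxΩ S hSm (hvΩ.mono fun y hy hyΩ => by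
      simp only [hS, mem_ofPred_eq, hy hyΩ, abs_zero]; positivity) hSV
    have hVσ : c * Θ t ^ q = Θ t * (C * V ^ (-σ)) := by
      have e1 : V ^ (-σ) = X₀ ^ (-σ) * (D ^ (-(q * σ)) * Θ t ^ (q * σ)) := by
        rw [hV, Real.mul_rpow hX₀pos.le (by positivity), ← Real.rpow_mul (by positivity),
          Real.div_rpow hD.le hΘt.le, div_eq_mul_inv, ← Real.rpow_neg hΘt.le]
        ring_nf
      have e2 : Θ t ^ q = Θ t * Θ t ^ (q * σ) := by
        conv_lhs => rw [← hqσ, Real.rpow_add hΘt, Real.rpow_one]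
      rw [e1, e2, hc]
      ring
    rw [← ENNReal.ofReal_mul hc0.le, hVσ, ENNReal.ofReal_mul hΘt.le]
    calc ENNReal.ofReal (Θ t) * ENNReal.ofReal (C * V ^ (-σ))
        ≤ ENNReal.ofReal (Θ t) * ∫⁻ y in S, ENNReal.ofReal (J (x - y)) := by gcongr
      _ = ∫⁻ y in S, ENNReal.ofReal (Θ t) * ENNReal.ofReal (J (x - y)) :=
          (lintegral_const_mul' _ _ ENNReal.ofReal_ne_top).symm
      _ ≤ ∫⁻ y in S, ENNReal.ofReal (F (v x) (v y) * J (x - y)) := by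
          refine lintegral_mono_ae ((ae_restrict_iff'₀ hSm).2 (ae_of_all _ fun y hy => ?_))
          have h3 := hF (v x) (v y) hvx hy
          rw [ENNReal.ofReal_mul (hΘt.le.trans h3)]
          gcongr
      _ ≤ _ := setLIntegral_le_lintegral _ _
  calc ENNReal.ofReal (C * D ^ (-(q * σ))) * X ^ (1 - σ)
      = ENNReal.ofReal c * X := by
        rw [hXeq, ENNReal.ofReal_rpow_of_pos hX₀pos, ← ENNReal.ofReal_mul (by positivity),
          ← ENNReal.ofReal_mul hc0.le, hc, show 1 - σ = -σ + 1 by ring,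
          Real.rpow_add hX₀pos, Real.rpow_one]
        ring_nf
    _ = ∫⁻ x, ENNReal.ofReal c * ENNReal.ofReal (Θ |v x| ^ q) :=
        (lintegral_const_mul' _ _ ENNReal.ofReal_ne_top).symm
    _ ≤ _ := lintegral_mono_ae key

/-! ### Power-like nonlinearities and the energy space -/

lemma IsNonlinearity.zero {ψ : ℝ → ℝ} (hψ : IsNonlinearity ψ) : ψ 0 = 0 := by
  have := hψ.odd 0
  rw [neg_zero] at this
  linarith

lemma IsNonlinearity.primitive_neg {ψ : ℝ → ℝ} (hψ : IsNonlinearity ψ) (s : ℝ) :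
    primitive ψ (-s) = primitive ψ s := by
  unfold primitive
  have h := intervalIntegral.integral_comp_neg (a := 0) (b := s) ψ
  simp only [hψ.odd, neg_zero, intervalIntegral.integral_neg] at h
  rw [intervalIntegral.integral_symm]
  linarith

lemma IsNonlinearity.primitive_abs {ψ : ℝ → ℝ} (hψ : IsNonlinearity ψ) (s : ℝ) :
    primitive ψ |s| = primitive ψ s := by
  rcases abs_choice s with h | h <;> rw [h]
  exact hψ.primitive_neg s

lemma IsNonlinearity.abs_apply {ψ : ℝ → ℝ} (hψ : IsNonlinearity ψ) (s : ℝ) : |ψ s| = ψ |s| := by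
  have h0 : 0 ≤ ψ |s| := hψ.zero ▸ hψ.monotone (abs_nonneg s)
  rcases abs_choice s with h | h
  · rw [h] at h0 ⊢; exact abs_of_nonneg h0
  · rw [h] at h0 ⊢; rw [hψ.odd] at h0 ⊢; exact abs_of_nonpos (by linarith)

lemma primitive_bounds {ψ : ℝ → ℝ} (hψ : IsNonlinearity ψ) {p c₁ c₂ : ℝ} (hp : 1 < p)
    (h : ∀ s : ℝ, 0 < s → c₁ * s ^ (p - 1) ≤ ψ s ∧ ψ s ≤ c₂ * s ^ (p - 1)) (s : ℝ) :
    c₁ / p * |s| ^ p ≤ primitive ψ s ∧ primitive ψ s ≤ c₂ / p * |s| ^ p := by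
  have hp0 : 0 < p := by linarith
  have hint : ∀ c : ℝ, ∫ t in (0 : ℝ)..|s|, c * t ^ (p - 1) = c / p * |s| ^ p := fun c => by
    rw [intervalIntegral.integral_const_mul, integral_rpow (Or.inl (by linarith)),
      sub_add_cancel, Real.zero_rpow hp0.ne']
    ring
  have hcont : ∀ c : ℝ, IntervalIntegrable (fun t : ℝ => c * t ^ (p - 1)) volume 0 |s| :=
    fun c => (intervalIntegral.intervalIntegrable_rpow' (by linarith)).const_mul c
  have hψi := hψ.continuous.intervalIntegrable (μ := volume) 0 |s|
  have h' : ∀ t ∈ Icc 0 |s|, c₁ * t ^ (p - 1) ≤ ψ t ∧ ψ t ≤ c₂ * t ^ (p - 1) := by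
    intro t ht
    rcases ht.1.eq_or_lt with rfl | ht0
    · rw [Real.zero_rpow (by linarith), hψ.zero]; simp
    · exact h t ht0
  rw [← hψ.primitive_abs s, ← hint, ← hint]
  exact ⟨intervalIntegral.integral_mono_on (abs_nonneg s) (hcont c₁) hψi fun t ht => (h' t ht).1,
    intervalIntegral.integral_mono_on (abs_nonneg s) hψi (hcont c₂) fun t ht => (h' t ht).2⟩

lemma aemeasurable_mul_kernel {N : ℕ} {J : RN N → ℝ} (hJ : Measurable J) {u : RN N → ℝ}
    (hu : AEStronglyMeasurable u) {F : ℝ → ℝ → ℝ} (hF : Measurable (Function.uncurry F)) :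
    AEMeasurable fun z : RN N × RN N => F (u z.1) (u z.2) * J (z.1 - z.2) := by
  have h1 : AEMeasurable (fun z : RN N × RN N => u z.1) := hu.comp_fst.aemeasurable
  have h2 : AEMeasurable (fun z : RN N × RN N => u z.2) := hu.comp_snd.aemeasurable
  exact (hF.comp_aemeasurable (h1.prodMk h2)).mul
    (hJ.comp (measurable_fst.sub measurable_snd)).aemeasurable

/-- The double integral of `|u(x) - u(y)| ^ p J(x - y)`. -/
noncomputable def gagliardo {N : ℕ} (J : RN N → ℝ) (p : ℝ) (u : RN N → ℝ) : ENNReal :=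
  ∫⁻ z : RN N × RN N, ENNReal.ofReal (|u z.1 - u z.2| ^ p * J (z.1 - z.2))

lemma gagliardo_lt_top {N : ℕ} {J : RN N → ℝ} {ψ : ℝ → ℝ} (hψ : IsNonlinearity ψ) {p : ℝ}
    (hp : 1 < p) (hψp : IsPowerLike ψ p) {u : RN N → ℝ} (hu : energy J ψ u < ⊤) :
    gagliardo J p u < ⊤ := by
  obtain ⟨c₁, c₂, hc₁, -, h⟩ := hψp
  have hp0 : 0 < p := by linarith
  set I := ∫⁻ z : RN N × RN N, ENNReal.ofReal (primitive ψ (u z.1 - u z.2) * J (z.1 - z.2)) with hI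
  have hItop : I ≠ ⊤ := by
    rintro hT
    rw [energy, ← hI, hT] at hu
    simp at hu
  refine lt_of_le_of_lt (b := ENNReal.ofReal (p / c₁) * I) ?_
    (ENNReal.mul_lt_top ENNReal.ofReal_lt_top hItop.lt_top)
  rw [hI, ← lintegral_const_mul' _ _ ENNReal.ofReal_ne_top]
  refine lintegral_mono fun z => ?_
  have h1 := (primitive_bounds hψ hp h (u z.1 - u z.2)).1
  rw [← ENNReal.ofReal_mul (by positivity), ← mul_assoc]
  have h2 : |u z.1 - u z.2| ^ p ≤ p / c₁ * primitive ψ (u z.1 - u z.2) := by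
    calc _ = p / c₁ * (c₁ / p * |u z.1 - u z.2| ^ p) := by field_simp
      _ ≤ _ := by gcongr
  rw [ENNReal.ofReal_mul (by positivity), ENNReal.ofReal_mul (le_trans (by positivity) h2)]
  gcongr

/-- Lipschitz functions vanishing at `0` operate on `W_0^{J,Ψ}(Ω)`. -/
lemma memW0_comp {N : ℕ} {Ω : Set (RN N)} {J : RN N → ℝ} {ψ : ℝ → ℝ} (hψ : IsNonlinearity ψ)
    {p : ℝ} (hp : 1 < p) (hψp : IsPowerLike ψ p) {u : RN N → ℝ} (hu : MemW0 J ψ Ω u) {G : ℝ → ℝ}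
    (hG0 : G 0 = 0) {L : ℝ} (hL : 0 ≤ L) (hG : ∀ a b, |G a - G b| ≤ L * |a - b|)
    (hGc : Continuous G) : MemW0 J ψ Ω fun x => G (u x) := by
  obtain ⟨c₁, c₂, hc₁, hc₂, h⟩ := hψp
  have hp0 : 0 < p := by linarith
  have hprim : ∀ s t : ℝ, |s| ≤ L * |t| →
      primitive ψ s ≤ c₂ / c₁ * L ^ p * primitive ψ t := fun s t hst => by
    calc primitive ψ s ≤ c₂ / p * |s| ^ p := (primitive_bounds hψ hp h s).2
      _ ≤ c₂ / p * (L * |t|) ^ p := by gcongr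
      _ = c₂ / c₁ * L ^ p * (c₁ / p * |t| ^ p) := by
          rw [Real.mul_rpow hL (abs_nonneg t)]; field_simp
      _ ≤ _ := by gcongr; exact (primitive_bounds hψ hp h t).1
  have hnn : ∀ s, 0 ≤ primitive ψ s := fun s =>
    le_trans (by positivity) (primitive_bounds hψ hp h s).1
  set K : ℝ := c₂ / c₁ * L ^ p with hK
  have hK0 : 0 ≤ K := by positivity
  refine ⟨⟨hGc.comp_aestronglyMeasurable hu.memW.aestronglyMeasurable, ?_, ?_⟩,
    hu.eq_zero.mono fun x hx hxΩ => by rw [hx hxΩ, hG0]⟩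
  · refine lt_of_le_of_lt (b := ENNReal.ofReal K * modular ψ u) ?_
      (ENNReal.mul_lt_top ENNReal.ofReal_lt_top hu.memW.modular_lt_top)
    rw [modular, modular, ← lintegral_const_mul' _ _ ENNReal.ofReal_ne_top]
    refine lintegral_mono fun x => ?_
    rw [← ENNReal.ofReal_mul hK0]
    refine ENNReal.ofReal_le_ofReal (hprim _ _ ?_)
    simpa [hG0] using hG (u x) 0
  · refine lt_of_le_of_lt (b := ENNReal.ofReal K * energy J ψ u) ?_
      (ENNReal.mul_lt_top ENNReal.ofReal_lt_top hu.memW.energy_lt_top)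
    rw [energy, energy, mul_left_comm, ← lintegral_const_mul' _ _ ENNReal.ofReal_ne_top]
    gcongr with z
    rw [ENNReal.ofReal_mul (hnn _), ENNReal.ofReal_mul (hnn _), ← mul_assoc,
      ← ENNReal.ofReal_mul hK0]
    gcongr
    exact hprim _ _ (hG _ _)

/-! ### The Sobolev exponent -/

/-- The fractional Sobolev embedding, in qualitative form. The level set inequality is applied to
the truncations of `u` at height `k`, whose integrals are finite because `Ω` has finite measure; the
resulting bound does not depend on `k`. -/
theorem lintegral_sobolev_lt_top {N : ℕ} {Ω : Set (RN N)} (hΩ : Bornology.IsBounded Ω)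
    {J : RN N → ℝ} (hJm : Measurable J) {C σ : ℝ} (hC : 0 < C)
    (hσ1 : σ < 1) (hJ : KernelMassBound J Ω C σ) {p : ℝ} (hp : 1 < p)
    {u : RN N → ℝ} (hu : AEStronglyMeasurable u)
    (huΩ : ∀ᵐ x, x ∉ Ω → u x = 0) (hE : gagliardo J p u < ⊤) :
    ∫⁻ x, ENNReal.ofReal (|u x| ^ (p / (1 - σ))) < ⊤ := by
  have hp0 : 0 < p := by linarith
  have hσ1' : 0 < 1 - σ := sub_pos.2 hσ1
  set q := 1 / (1 - σ) with hq
  have hq0 : 0 < q := by positivity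
  set Θ : ℝ → ℝ := fun t => (t / 2) ^ p with hΘ
  have hΘc : Continuous Θ := (continuous_id.div_const 2).rpow_const fun _ => Or.inr hp0.le
  set T : ℕ → ℝ → ℝ := fun k t => max (-k) (min k t) with hT
  have hTc : ∀ k, Continuous (T k) := fun k =>
    continuous_const.max (continuous_const.min continuous_id)
  have hT0 : ∀ k, T k 0 = 0 := fun k => by simp [hT]
  have hTk : ∀ k t, |T k t| ≤ k := fun k t => by
    rw [abs_le]
    exact ⟨le_max_left _ _, max_le (by linarith [(Nat.cast_nonneg k : (0 : ℝ) ≤ k)])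
      (min_le_left _ _)⟩
  have hTL : ∀ k a b, |T k a - T k b| ≤ |a - b| := fun k a b =>
    (abs_max_sub_max_le_max _ _ _ _).trans (max_le (by simp)
      ((abs_min_sub_min_le_max _ _ _ _).trans (max_le (by simp) le_rfl)))
  have hTev : ∀ t, ∀ᶠ k : ℕ in atTop, T k t = t := fun t => by
    filter_upwards [eventually_ge_atTop ⌈|t|⌉₊] with k hk
    have h1 : |t| ≤ k := (Nat.le_ceil _).trans (by exact_mod_cast hk)
    rw [abs_le] at h1
    simp [hT, h1.1, h1.2]
  have hmeas : ∀ k, AEMeasurable fun x => T k (u x) := fun k =>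
    ((hTc k).comp_aestronglyMeasurable hu).aemeasurable
  set M : ENNReal :=
    (gagliardo J p u / ENNReal.ofReal (C * (2 ^ p) ^ (-(q * σ)))) ^ (1 / (1 - σ - 0)) with hM
  have hMtop : M < ⊤ := by
    refine ENNReal.rpow_lt_top_of_nonneg (by rw [sub_zero]; positivity)
      (ENNReal.div_ne_top hE.ne ?_)
    rw [Ne, ENNReal.ofReal_eq_zero, not_le]; positivity
  have hbound : ∀ k, ∫⁻ x, ENNReal.ofReal (Θ |T k (u x)| ^ q) ≤ M := fun k => by
    have hfin : ∫⁻ x, ENNReal.ofReal (Θ |T k (u x)| ^ q) ≠ ⊤ := by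
      refine (lt_of_le_of_lt (b := ENNReal.ofReal (Θ k ^ q) * volume Ω) ?_
        (ENNReal.mul_lt_top ENNReal.ofReal_lt_top hΩ.measure_lt_top)).ne
      rw [← setLIntegral_const]
      refine le_trans ?_ (lintegral_indicator_le _ _)
      refine lintegral_mono_ae (huΩ.mono fun x hx => ?_)
      by_cases hxΩ : x ∈ Ω
      · rw [indicator_of_mem hxΩ]
        apply ENNReal.ofReal_le_ofReal
        simp only [hΘ]
        gcongr
        exact hTk k _
      · simp [hx hxΩ, hT0, hΘ, Real.zero_rpow hp0.ne', Real.zero_rpow hq0.ne']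
    have h := level_set_sobolev hC hσ1 hJ (hmeas k)
      (huΩ.mono fun x hx hxΩ => by rw [hx hxΩ, hT0]) (Θ := Θ)
      (fun a ha b _ hab => by
        have ha' : (0 : ℝ) ≤ a := ha
        simp only [hΘ]; gcongr)
      (by simp [hΘ, Real.zero_rpow hp0.ne'])
      (fun t ht => by simp only [hΘ]; positivity)
      (D := 2 ^ p) (by positivity)
      (fun t ht => by
        simp only [hΘ]
        rw [← Real.mul_rpow (by norm_num) (by positivity)]
        exact le_of_eq (by ring_nf))
      (F := fun a b => |a - b| ^ p)
      (fun a b _ hab => by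
        simp only [hΘ]
        gcongr
        linarith [abs_sub_abs_le_abs_sub a b])
      hfin
    refine le_of_mul_rpow_le_mul_rpow (by positivity) hfin le_rfl hσ1' ?_
    rw [ENNReal.rpow_zero, mul_one]
    refine h.trans ?_
    rw [gagliardo, Measure.volume_eq_prod, lintegral_prod _
      (aemeasurable_mul_kernel hJm hu (F := fun a b => |a - b| ^ p)
        (by unfold Function.uncurry; fun_prop)).ennreal_ofReal]
    refine lintegral_mono fun x => lintegral_mono fun y => ?_
    rw [ENNReal.ofReal_mul (by positivity), ENNReal.ofReal_mul (by positivity)]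
    gcongr ENNReal.ofReal ?_ * _
    exact Real.rpow_le_rpow (abs_nonneg _) (hTL k _ _) hp0.le
  have hlim : ∫⁻ x, ENNReal.ofReal (Θ |u x| ^ q) ≤ M := by
    refine lintegral_le_of_eventually_eq (fun k => ?_)
      (fun x => (hTev (u x)).mono fun k hk => by rw [hk]) hbound
    exact ((((hΘc.comp continuous_abs).rpow_const
      fun _ => Or.inr hq0.le).measurable.comp_aemeasurable (hmeas k))).ennreal_ofReal
  have hpq : p / (1 - σ) = p * q := by rw [hq]; ring
  have heq : ∀ x, ENNReal.ofReal (|u x| ^ (p / (1 - σ))) =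
      ENNReal.ofReal (2 ^ (p * q)) * ENNReal.ofReal (Θ |u x| ^ q) := fun x => by
    rw [← ENNReal.ofReal_mul (by positivity), hpq, hΘ]
    dsimp only
    rw [← Real.rpow_mul (by positivity), ← Real.mul_rpow (by norm_num) (by positivity)]
    congr 2
    ring
  simp_rw [heq]
  rw [lintegral_const_mul' _ _ ENNReal.ofReal_ne_top]
  exact ENNReal.mul_lt_top ENNReal.ofReal_lt_top (hlim.trans_lt hMtop)

/-! ### Truncated powers -/

/-- The odd function `t ↦ t min(|t|, k) ^ b`, a Lipschitz truncation of `t ↦ t |t| ^ b`. -/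
noncomputable def truncPow (b k t : ℝ) : ℝ := t * min |t| k ^ b

lemma truncPow_zero (b k : ℝ) : truncPow b k 0 = 0 := by simp [truncPow]

lemma truncPow_neg (b k t : ℝ) : truncPow b k (-t) = -truncPow b k t := by simp [truncPow]

lemma continuous_truncPow {b : ℝ} (hb : 0 ≤ b) (k : ℝ) : Continuous (truncPow b k) :=
  continuous_id.mul ((continuous_abs.min continuous_const).rpow_const fun _ => Or.inr hb)

lemma abs_truncPow {b k : ℝ} (hk : 0 ≤ k) (t : ℝ) : |truncPow b k t| = |t| * min |t| k ^ b := by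
  have : 0 ≤ min |t| k := le_min (abs_nonneg t) hk
  rw [truncPow, abs_mul, abs_of_nonneg (Real.rpow_nonneg this b)]

lemma truncPow_monotoneOn {b k : ℝ} (hb : 0 ≤ b) (hk : 0 ≤ k) :
    MonotoneOn (truncPow b k) (Ici 0) := by
  intro s hs t _ hst
  have hs' : (0 : ℝ) ≤ s := hs
  have ht : 0 ≤ t := hs'.trans hst
  have : 0 ≤ min |s| k := le_min (abs_nonneg s) hk
  unfold truncPow
  rw [abs_of_nonneg hs'] at *
  rw [abs_of_nonneg ht]
  gcongr

lemma truncPow_monotone {b k : ℝ} (hb : 0 ≤ b) (hk : 0 ≤ k) : Monotone (truncPow b k) :=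
  monotone_of_odd_of_monotoneOn_nonneg (truncPow_neg b k) (truncPow_monotoneOn hb hk)

/-- On `[0, k]` the function `t ↦ t ^ (b + 1)` has slope at most `(b + 1) k ^ b`, and beyond `k`
the function is linear with slope `k ^ b`. -/
lemma truncPow_sub_le {b k : ℝ} (hb : 0 ≤ b) (hk : 0 < k) {s t : ℝ} (hs : 0 ≤ s) (hst : s ≤ t) :
    truncPow b k t - truncPow b k s ≤ (b + 1) * k ^ b * (t - s) := by
  have ht : 0 ≤ t := hs.trans hst
  have hkb : 0 < k ^ b := Real.rpow_pos_of_pos hk b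
  have hsmall : ∀ s t : ℝ, 0 ≤ s → s ≤ t → t ≤ k →
      truncPow b k t - truncPow b k s ≤ (b + 1) * k ^ b * (t - s) := by
    intro s t hs hst htk
    have ht : 0 ≤ t := hs.trans hst
    have hval : ∀ x, 0 ≤ x → x ≤ k → truncPow b k x = x ^ (b + 1) := fun x hx hxk => by
      rw [truncPow, abs_of_nonneg hx, min_eq_left hxk,
        Real.rpow_add_of_nonneg hx hb zero_le_one, Real.rpow_one, mul_comm]
    rw [hval t ht htk, hval s hs (hst.trans htk)]
    refine (convex_Icc 0 k).image_sub_le_mul_sub_of_deriv_le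
      (Real.continuous_rpow_const (by linarith)).continuousOn
      (Real.differentiable_rpow_const (by linarith)).differentiableOn ?_ s ⟨hs, hst.trans htk⟩
      t ⟨ht, htk⟩ hst
    intro x hx
    rw [interior_Icc] at hx
    rw [Real.deriv_rpow_const, add_sub_cancel_right]
    have := hx.1.le
    have := hx.2.le
    gcongr
  have hlarge : ∀ s t : ℝ, k ≤ s → s ≤ t →
      truncPow b k t - truncPow b k s ≤ (b + 1) * k ^ b * (t - s) := by
    intro s t hs hst
    have hval : ∀ x, k ≤ x → truncPow b k x = x * k ^ b := fun x hx => by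
      rw [truncPow, abs_of_nonneg (hk.le.trans hx), min_eq_right hx]
    rw [hval t (hs.trans hst), hval s hs]
    nlinarith [mul_nonneg hb (mul_nonneg hkb.le (sub_nonneg.2 hst))]
  rcases le_total t k with h | h
  · exact hsmall s t hs hst h
  rcases le_total k s with h' | h'
  · exact hlarge s t h' hst
  · linarith [hsmall s k hs h' le_rfl, hlarge k t le_rfl h]

lemma abs_truncPow_sub_le {b k : ℝ} (hb : 0 ≤ b) (hk : 0 < k) (s t : ℝ) :
    |truncPow b k s - truncPow b k t| ≤ (b + 1) * k ^ b * |s - t| := by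
  have hmain : ∀ s t : ℝ, s ≤ t →
      truncPow b k t - truncPow b k s ≤ (b + 1) * k ^ b * (t - s) := by
    intro s t hst
    rcases le_total 0 s with hs | hs
    · exact truncPow_sub_le hb hk hs hst
    rcases le_total 0 t with ht | ht
    · have h1 := truncPow_sub_le hb hk le_rfl ht
      have h2 := truncPow_sub_le hb hk le_rfl (neg_nonneg.2 hs)
      rw [truncPow_neg] at h2
      rw [truncPow_zero] at h1 h2
      linarith
    · have h2 := truncPow_sub_le hb hk (neg_nonneg.2 ht) (neg_le_neg hst)
      rw [truncPow_neg, truncPow_neg] at h2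
      linarith
  rcases le_total s t with h | h
  · rw [abs_sub_comm, abs_sub_comm s t, abs_of_nonneg (sub_nonneg.2 h),
      abs_of_nonneg (sub_nonneg.2 (truncPow_monotone hb hk.le h))]
    exact hmain s t h
  · rw [abs_of_nonneg (sub_nonneg.2 h),
      abs_of_nonneg (sub_nonneg.2 (truncPow_monotone hb hk.le h))]
    exact hmain t s h

lemma truncPow_half_le {b k : ℝ} (hb : 0 ≤ b) (hk : 0 ≤ k) {t : ℝ} (ht : 0 ≤ t) :
    truncPow b k (t / 2) ≤ truncPow b k t / 2 := by
  have : 0 ≤ min |t / 2| k := le_min (abs_nonneg _) hk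
  unfold truncPow
  rw [abs_of_nonneg ht, abs_of_nonneg (by positivity : 0 ≤ t / 2)] at *
  calc t / 2 * min (t / 2) k ^ b ≤ t / 2 * min t k ^ b := by gcongr; linarith
    _ = _ := by ring

/-- Coercivity of the interaction density where `|s|` is at most half of `|a|`. -/
lemma le_mul_truncPow_sub {ψ : ℝ → ℝ} (hψ : IsNonlinearity ψ) {p c₁ : ℝ}
    (hc₁ : 0 < c₁) (h : ∀ s : ℝ, 0 < s → c₁ * s ^ (p - 1) ≤ ψ s) {b k : ℝ} (hb : 0 ≤ b)
    (hk : 0 ≤ k) {a s : ℝ} (ha : a ≠ 0) (hs : |s| ≤ |a| / 2) :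
    |a| ^ p * min |a| k ^ b ≤
      2 ^ p / c₁ * (ψ (a - s) * (truncPow b k a - truncPow b k s)) := by
  have hpos : ∀ a s : ℝ, 0 < a → |s| ≤ a / 2 → a ^ p * min a k ^ b ≤
      2 ^ p / c₁ * (ψ (a - s) * (truncPow b k a - truncPow b k s)) := by
    intro a s ha hs
    have hs1 := (abs_le.1 hs).2
    have h1 : c₁ * (a / 2) ^ (p - 1) ≤ ψ (a - s) :=
      (h (a / 2) (by positivity)).trans (hψ.monotone (by linarith))
    have hm : 0 ≤ min a k := le_min ha.le hk
    have h2 : a * min a k ^ b / 2 ≤ truncPow b k a - truncPow b k s := by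
      have h3 := truncPow_monotone hb hk hs1
      have h4 := truncPow_half_le hb hk ha.le
      have h5 : truncPow b k a = a * min a k ^ b := by rw [truncPow, abs_of_pos ha]
      linarith
    have h0 : 0 ≤ ψ (a - s) := le_trans (by positivity) h1
    calc a ^ p * min a k ^ b
        = 2 ^ p / c₁ * (c₁ * (a / 2) ^ (p - 1) * (a * min a k ^ b / 2)) := by
          rw [Real.div_rpow ha.le (by norm_num), Real.rpow_sub_one ha.ne',
            Real.rpow_sub_one (by norm_num)]
          have : (2 : ℝ) ^ p ≠ 0 := by positivity
          field_simp
      _ ≤ _ := by gcongr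
  rcases lt_or_gt_of_ne ha with ha | ha
  · have := hpos (-a) (-s) (by linarith) (by rwa [abs_neg, ← abs_of_neg ha])
    rw [abs_of_neg ha]
    rw [show -a - -s = -(a - s) by ring, hψ.odd, truncPow_neg, truncPow_neg] at this
    linarith
  · rw [abs_of_pos ha] at hs ⊢
    exact hpos a s ha hs

/-! ### The weak formulation with a test function `G ∘ u` -/

/-- For a weak solution tested with a Lipschitz function `G ∘ u`, `G` nondecreasing, the
interaction is the integral of a nonnegative integrable function, so that the weak formulation
may be read with Lebesgue integrals, and Hölder's inequality bounds it. -/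
lemma lintegral_interaction_le {N : ℕ} {Ω : Set (RN N)} {J : RN N → ℝ} (hJ : IsKernel J)
    {ψ : ℝ → ℝ} (hψ : IsNonlinearity ψ) {p : ℝ} (hp : 1 < p) (hψp : IsPowerLike ψ p)
    {f u : RN N → ℝ} (hu : IsWeakSolution J ψ Ω f u) {m m' : ℝ} (hm : m.HolderConjugate m')
    (hf : AEStronglyMeasurable f (volume.restrict Ω)) {G : ℝ → ℝ}
    (hG0 : G 0 = 0) (hGm : Monotone G) {L : ℝ} (hL : 0 ≤ L)
    (hG : ∀ a b, |G a - G b| ≤ L * |a - b|) (hGc : Continuous G) :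
    ∫⁻ x, ∫⁻ y, ENNReal.ofReal (ψ (u x - u y) * (G (u x) - G (u y)) * J (x - y)) ≤
      2 * ((∫⁻ x in Ω, ‖f x‖ₑ ^ m) ^ (1 / m) *
        (∫⁻ x, ENNReal.ofReal (|G (u x)| ^ m')) ^ (1 / m')) := by
  have hφ := memW0_comp hψ hp hψp hu.memW0 hG0 hL hG hGc
  have hum := hu.memW0.memW.aestronglyMeasurable
  have hFm : Measurable (Function.uncurry fun a b => ψ (a - b) * (G a - G b)) := by
    have := hψ.continuous.measurable
    have := hGc.measurable
    unfold Function.uncurry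
    fun_prop
  have hmeas := aemeasurable_mul_kernel hJ.measurable hum hFm
  set I : RN N × RN N → ℝ :=
    fun z => ψ (u z.1 - u z.2) * (G (u z.1) - G (u z.2)) * J (z.1 - z.2) with hI
  have hFnn : ∀ a b, 0 ≤ ψ (a - b) * (G a - G b) := fun a b => by
    rcases le_total a b with hab | hab
    · exact mul_nonneg_of_nonpos_of_nonpos (hψ.zero ▸ hψ.monotone (sub_nonpos.2 hab))
        (sub_nonpos.2 (hGm hab))
    · exact mul_nonneg (hψ.zero ▸ hψ.monotone (sub_nonneg.2 hab)) (sub_nonneg.2 (hGm hab))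
  have hInn : ∀ z, 0 ≤ I z := fun z => by
    -- on the diagonal `J 0` may be negative, but the other factors vanish
    by_cases hz : z.1 = z.2
    · simp [hI, hz]
    · exact mul_nonneg (hFnn _ _) (hJ.pos _ (sub_ne_zero.2 hz)).le
  have hIint : Integrable I := by
    refine ⟨hmeas.aestronglyMeasurable, ?_⟩
    have hgag := gagliardo_lt_top hψ hp hψp hu.memW0.memW.energy_lt_top
    obtain ⟨c₁, c₂, hc₁, hc₂, h⟩ := hψp
    rw [hasFiniteIntegral_iff_ofReal (ae_of_all _ hInn)]
    refine lt_of_le_of_lt (b := ENNReal.ofReal (c₂ * L) * gagliardo J p u) ?_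
      (ENNReal.mul_lt_top ENNReal.ofReal_lt_top hgag)
    rw [gagliardo, ← lintegral_const_mul' _ _ ENNReal.ofReal_ne_top]
    refine lintegral_mono fun z => ?_
    rw [← ENNReal.ofReal_mul (by positivity), ← mul_assoc, hI]
    dsimp only
    rw [ENNReal.ofReal_mul (hFnn _ _),
      ENNReal.ofReal_mul (by positivity : 0 ≤ c₂ * L * |u z.1 - u z.2| ^ p)]
    gcongr ENNReal.ofReal ?_ * _
    set d := u z.1 - u z.2 with hd
    have h1 : |ψ d| ≤ c₂ * |d| ^ (p - 1) := by
      rw [hψ.abs_apply]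
      rcases (abs_nonneg d).eq_or_lt with h0 | h0
      · rw [← h0, hψ.zero, Real.zero_rpow (by linarith), mul_zero]
      · exact (h _ h0).2
    calc ψ d * (G (u z.1) - G (u z.2)) ≤ |ψ d| * |G (u z.1) - G (u z.2)| := by
          rw [← abs_mul]; exact le_abs_self _
      _ ≤ c₂ * |d| ^ (p - 1) * (L * |d|) := by gcongr; exact hG _ _
      _ = c₂ * L * (|d| ^ (p - 1) * |d|) := by ring
      _ = c₂ * L * |d| ^ p := by
          rcases (abs_nonneg d).eq_or_lt with h0 | h0
          · rw [← h0, Real.zero_rpow (by linarith : p ≠ 0), mul_zero]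
          · rw [Real.rpow_sub_one h0.ne', div_mul_cancel₀ _ h0.ne']
  have hweak : ∫ z, I z = 2 * ∫ x in Ω, f x * G (u x) := by
    rw [← hu.weak_eq _ hφ, interaction]
    ring
  calc _ = ∫⁻ z, ENNReal.ofReal (I z) := by
        rw [Measure.volume_eq_prod, lintegral_prod _ hmeas.ennreal_ofReal]
    _ = ENNReal.ofReal (2 * ∫ x in Ω, f x * G (u x)) := by
        rw [← hweak, ofReal_integral_eq_lintegral_ofReal hIint (ae_of_all _ hInn)]
    _ ≤ 2 * ∫⁻ x in Ω, ‖f x‖ₑ * ‖G (u x)‖ₑ := by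
        rw [ENNReal.ofReal_mul zero_le_two, ENNReal.ofReal_ofNat]
        gcongr
        refine (Real.ofReal_le_enorm _).trans ((enorm_integral_le_lintegral_enorm _).trans ?_)
        simp_rw [enorm_mul]
        exact le_rfl
    _ ≤ 2 * ((∫⁻ x in Ω, ‖f x‖ₑ ^ m) ^ (1 / m) *
          (∫⁻ x in Ω, ‖G (u x)‖ₑ ^ m') ^ (1 / m')) := by
        gcongr
        exact ENNReal.lintegral_mul_le_Lp_mul_Lq _ hm hf.enorm
          (hGc.comp_aestronglyMeasurable hum).restrict.enorm
    _ ≤ _ := by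
        have hm' := hm.symm.pos
        gcongr 2 * (_ * ?_ ^ (1 / m'))
        refine (setLIntegral_le_lintegral _ _).trans (lintegral_mono fun x => ?_)
        rw [← ofReal_norm, Real.norm_eq_abs,
          ENNReal.ofReal_rpow_of_nonneg (abs_nonneg _) hm'.le]

/-! ### Integrability beyond the Sobolev exponent -/

lemma HasSingularity.mono {N : ℕ} {J : RN N → ℝ} {α α' : ℝ} (h : HasSingularity J α)
    (hα : α' ≤ α) : HasSingularity J α' := by
  obtain ⟨c, hc, hJ⟩ := h
  refine ⟨c, hc, fun z h0 h1 => le_trans ?_ (hJ z h0 h1)⟩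
  gcongr c * ?_
  exact Real.rpow_le_rpow_of_exponent_ge h0 h1.le (by linarith)

/-- The two sides agree at `s = t` by the choice of the exponents, and their quotient is
`(t / s) ^ (p q - m')`, with `p q - m' = b (m' - q) ≥ 0`. -/
lemma mul_rpow_rpow_le {t s b p q m' : ℝ} (hs : 0 ≤ s) (hst : s ≤ t) (hb : 0 ≤ b) (hq : 0 < q)
    (hqm : q ≤ m') (hexp : (p + b) * q = (1 + b) * m') :
    (t * s ^ b) ^ m' ≤ (t ^ p * s ^ b) ^ q := by
  have hm' : 0 < m' := hq.trans_le hqm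
  have hpq : 0 ≤ p * q - m' := by nlinarith [mul_nonneg hb (sub_nonneg.2 hqm)]
  rcases (hs.trans hst).eq_or_lt with rfl | ht
  · rw [zero_mul, Real.zero_rpow hm'.ne']
    exact Real.rpow_nonneg (by positivity) _
  rcases hs.eq_or_lt with rfl | hs0
  · rcases hb.eq_or_lt with rfl | hb0
    · have : p * q = m' := by linarith
      simp only [Real.rpow_zero, mul_one]
      rw [← Real.rpow_mul ht.le, this]
    · rw [Real.zero_rpow hb0.ne', mul_zero, mul_zero, Real.zero_rpow hm'.ne',
        Real.zero_rpow hq.ne']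
  · rw [Real.mul_rpow ht.le (by positivity), Real.mul_rpow (by positivity) (by positivity),
      ← Real.rpow_mul hs, ← Real.rpow_mul hs, ← Real.rpow_mul ht.le]
    calc t ^ m' * s ^ (b * m') = t ^ m' * (s ^ (p * q - m') * s ^ (b * q)) := by
          rw [← Real.rpow_add hs0]
          congr 2
          linarith
      _ ≤ t ^ m' * (t ^ (p * q - m') * s ^ (b * q)) := by gcongr
      _ = t ^ (p * q) * s ^ (b * q) := by
          rw [← mul_assoc, ← Real.rpow_add ht]
          congr 2
          ring

/-- The gain of integrability beyond the Sobolev exponent: a solution with data in `L^m` has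
a finite integral of order `(p + b) q`, where `q = 1 / (1 - σ)` and `b` is the exponent making
`|truncPow b k u| ^ m'` comparable with `(|u| ^ p min(|u|, k) ^ b) ^ q`. -/
theorem lintegral_lt_top_of_test {N : ℕ} {Ω : Set (RN N)} {J : RN N → ℝ} (hJ : IsKernel J)
    {ψ : ℝ → ℝ} (hψ : IsNonlinearity ψ) {p : ℝ} (hp : 1 < p) (hψp : IsPowerLike ψ p)
    {C σ : ℝ} (hC : 0 < C) (hσ1 : σ < 1) (hJΩ : KernelMassBound J Ω C σ)
    {m m' : ℝ} (hm : m.HolderConjugate m') (hmσ : 1 / m' < 1 - σ) {f u : RN N → ℝ}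
    (hf : MemLp f (ENNReal.ofReal m) (volume.restrict Ω)) (hu : IsWeakSolution J ψ Ω f u)
    (hsob : ∫⁻ x, ENNReal.ofReal (|u x| ^ (p / (1 - σ))) < ⊤) {b : ℝ} (hb : 0 ≤ b)
    (hexp : (p + b) * (1 / (1 - σ)) = (1 + b) * m') :
    ∫⁻ x, ENNReal.ofReal (|u x| ^ ((p + b) * (1 / (1 - σ)))) < ⊤ := by
  have hp0 : 0 < p := by linarith
  have hσ1' : 0 < 1 - σ := sub_pos.2 hσ1
  have hm0 := hm.pos
  have hm'0 := hm.symm.pos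
  have hum := hu.memW0.memW.aestronglyMeasurable
  set q := 1 / (1 - σ) with hq
  have hq0 : 0 < q := by positivity
  have hqm : q ≤ m' := by
    rw [hq, div_le_iff₀ hσ1', mul_comm, ← div_le_iff₀ hm'0]
    exact hmσ.le
  obtain ⟨c₁, c₂, hc₁, -, hc⟩ := id hψp
  set Θ : ℕ → ℝ → ℝ := fun k t => t ^ p * min t (k + 1) ^ b with hΘ
  have hΘc : ∀ k, Continuous (Θ k) := fun k =>
    (continuous_id.rpow_const fun _ => Or.inr hp0.le).mul
      ((continuous_id.min continuous_const).rpow_const fun _ => Or.inr hb)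
  set A := (∫⁻ x in Ω, ‖f x‖ₑ ^ m) ^ (1 / m) with hA
  have hAtop : A ≠ ⊤ := by
    refine ENNReal.rpow_ne_top_of_nonneg (by positivity) ?_
    have := lintegral_rpow_enorm_lt_top_of_eLpNorm_lt_top (by simpa using hm0)
      ENNReal.ofReal_ne_top hf.2
    rw [ENNReal.toReal_ofReal hm0.le] at this
    exact this.ne
  set B := ENNReal.ofReal (2 ^ p / c₁) * (2 * A) with hB
  have hBtop : B ≠ ⊤ := ENNReal.mul_ne_top ENNReal.ofReal_ne_top
    (ENNReal.mul_ne_top ENNReal.ofNat_ne_top hAtop)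
  set D : ℝ := 2 ^ p * 2 ^ b with hD
  set M := (B / ENNReal.ofReal (C * D ^ (-(q * σ)))) ^ (1 / (1 - σ - 1 / m')) with hM
  have hMtop : M < ⊤ := by
    refine ENNReal.rpow_lt_top_of_nonneg (one_div_nonneg.2 (sub_nonneg.2 hmσ.le))
      (ENNReal.div_ne_top hBtop ?_)
    rw [Ne, ENNReal.ofReal_eq_zero, not_le]
    positivity
  have hbound : ∀ k, ∫⁻ x, ENNReal.ofReal (Θ k |u x| ^ q) ≤ M := fun k => by
    have hk : (0 : ℝ) < k + 1 := by positivity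
    have hfin : ∫⁻ x, ENNReal.ofReal (Θ k |u x| ^ q) ≠ ⊤ := by
      refine (lt_of_le_of_lt (b := ENNReal.ofReal (((k : ℝ) + 1) ^ (b * q)) *
        ∫⁻ x, ENNReal.ofReal (|u x| ^ (p / (1 - σ)))) ?_
        (ENNReal.mul_lt_top ENNReal.ofReal_lt_top hsob)).ne
      rw [← lintegral_const_mul' _ _ ENNReal.ofReal_ne_top]
      refine lintegral_mono fun x => ?_
      rw [← ENNReal.ofReal_mul (by positivity)]
      apply ENNReal.ofReal_le_ofReal
      have h0 : 0 ≤ min |u x| ((k : ℝ) + 1) := le_min (abs_nonneg _) hk.le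
      calc Θ k |u x| ^ q ≤ (|u x| ^ p * ((k : ℝ) + 1) ^ b) ^ q := by
            simp only [hΘ]
            gcongr
            exact min_le_right _ _
        _ = _ := by
            rw [Real.mul_rpow (by positivity) (by positivity), ← Real.rpow_mul (abs_nonneg _),
              ← Real.rpow_mul hk.le, hq, mul_one_div, mul_comm]
    have h := level_set_sobolev hC hσ1 hJΩ hum.aemeasurable hu.memW0.eq_zero (Θ := Θ k)
      (fun s hs t _ hst => by
        have hs' : (0 : ℝ) ≤ s := hs
        have ht' : 0 ≤ t := hs'.trans hst
        have : 0 ≤ min s ((k : ℝ) + 1) := le_min hs' hk.le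
        simp only [hΘ]
        gcongr)
      (by simp [hΘ, Real.zero_rpow hp0.ne'])
      (fun t ht => by
        have : 0 < min t ((k : ℝ) + 1) := lt_min ht hk
        simp only [hΘ]
        positivity)
      (D := D) (by positivity)
      (fun t ht => by
        have h1 : min t ((k : ℝ) + 1) ≤ 2 * min (t / 2) ((k : ℝ) + 1) := by
          rw [mul_min_of_nonneg _ _ zero_le_two]
          exact min_le_min (by linarith) (by linarith)
        have h2 : 0 ≤ min t ((k : ℝ) + 1) := le_min ht.le hk.le
        have h3 : 0 ≤ min (t / 2) ((k : ℝ) + 1) := le_min (by positivity) hk.le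
        calc Θ k t ≤ (2 * (t / 2)) ^ p * (2 * min (t / 2) ((k : ℝ) + 1)) ^ b := by
              simp only [hΘ]
              gcongr
              linarith
          _ = D * Θ k (t / 2) := by
              rw [Real.mul_rpow zero_le_two (by positivity), Real.mul_rpow zero_le_two h3]
              simp only [hΘ, hD]
              ring)
      (fun a s ha hs =>
        le_mul_truncPow_sub hψ hc₁ (fun s hs => (hc s hs).1) hb hk.le ha hs)
      hfin
    refine le_of_mul_rpow_le_mul_rpow (by positivity) hfin (by positivity) hmσ (h.trans ?_)
    have hint := lintegral_interaction_le hJ hψ hp hψp hu hm hf.1 (truncPow_zero b (k + 1))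
      (truncPow_monotone hb hk.le) (by positivity) (abs_truncPow_sub_le hb hk)
      (continuous_truncPow hb _)
    have hcomp : ∫⁻ x, ENNReal.ofReal (|truncPow b (k + 1) (u x)| ^ m') ≤
        ∫⁻ x, ENNReal.ofReal (Θ k |u x| ^ q) := by
      refine lintegral_mono fun x => ENNReal.ofReal_le_ofReal ?_
      rw [abs_truncPow hk.le]
      exact mul_rpow_rpow_le (le_min (abs_nonneg _) hk.le) (min_le_left _ _) hb hq0 hqm hexp
    have hpull : ∀ x y : RN N, ENNReal.ofReal (2 ^ p / c₁ *
        (ψ (u x - u y) * (truncPow b (k + 1) (u x) - truncPow b (k + 1) (u y))) * J (x - y)) =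
        ENNReal.ofReal (2 ^ p / c₁) * ENNReal.ofReal
        (ψ (u x - u y) * (truncPow b (k + 1) (u x) - truncPow b (k + 1) (u y)) * J (x - y)) :=
      fun x y => by rw [← ENNReal.ofReal_mul (by positivity), mul_assoc]
    simp_rw [hpull, lintegral_const_mul' _ _ ENNReal.ofReal_ne_top]
    rw [hB, mul_assoc, mul_assoc]
    gcongr
    refine hint.trans ?_
    gcongr
  refine (lintegral_le_of_eventually_eq (g := fun k x => ENNReal.ofReal (Θ k |u x| ^ q))
    (fun k => ?_) (fun x => ?_) hbound).trans_lt hMtop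
  · exact (((hΘc k).comp continuous_abs).rpow_const
      fun _ => Or.inr hq0.le).measurable.comp_aemeasurable hum.aemeasurable |>.ennreal_ofReal
  · filter_upwards [eventually_ge_atTop ⌈|u x|⌉₊] with k hk
    have h1 : |u x| ≤ k := (Nat.le_ceil _).trans (by exact_mod_cast hk)
    simp only [hΘ]
    rw [min_eq_left (by linarith), ← Real.rpow_add_of_nonneg (abs_nonneg _) hp0.le hb,
      ← Real.rpow_mul (abs_nonneg _)]

end NonlocalOrlicz

open NonlocalOrlicz

theorem theorem4p3 {N : ℕ} (Ω : Set (NonlocalOrlicz.RN N)) (hΩ_open : IsOpen Ω)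
    (hΩ_bdd : Bornology.IsBounded Ω)
    (J : NonlocalOrlicz.RN N → ℝ) (hJ : NonlocalOrlicz.IsKernel J)
    (ψ : ℝ → ℝ) (hψ : NonlocalOrlicz.IsNonlinearity ψ)
    (p : ℝ) (hp : 1 < p) (hψp : NonlocalOrlicz.IsPowerLike ψ p)
    (α : ℝ) (hα : 0 < α) (hJα : NonlocalOrlicz.HasSingularity J α)
    (m : ℝ) (hm : 0 < m) (hmα : m < N / α)
    (f : NonlocalOrlicz.RN N → ℝ)
    (hf : MemLp f (ENNReal.ofReal m) (volume.restrict Ω))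
    (u : NonlocalOrlicz.RN N → ℝ) (hu : NonlocalOrlicz.IsWeakSolution J ψ Ω f u) :
    MemLp u (ENNReal.ofReal (m * (p - 1) * N / (N - m * α))) (volume.restrict Ω) := by
  have hN : N ≠ 0 := by
    -- for `N = 0` the condition on `m` reads `m < 0`
    rintro rfl
    simp only [Nat.cast_zero, zero_div] at hmα
    linarith
  have hN0 : (0 : ℝ) < N := by exact_mod_cast Nat.pos_of_ne_zero hN
  have hden : 0 < N - m * α := by
    rw [lt_div_iff₀ hα] at hmα
    linarith
  have hp1 : 0 < p - 1 := by linarith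
  set r := m * (p - 1) * N / (N - m * α) with hr
  have hr0 : 0 < r := by positivity
  have hum := hu.memW0.memW.aestronglyMeasurable
  have hsob : ∀ α' : ℝ, 0 < α' → α' ≤ α → α' < N →
      (∃ C, 0 < C ∧ KernelMassBound J Ω C (α' / N)) ∧
      ∫⁻ x, ENNReal.ofReal (|u x| ^ (p / (1 - α' / N))) < ⊤ := by
    intro α' h0 hα' hN'
    obtain ⟨C, hC, hCJ⟩ := exists_le_setLIntegral_kernel hN hΩ_bdd hΩ_open.measurableSet hJ h0
      (hJα.mono hα')
    exact ⟨⟨C, hC, hCJ⟩, lintegral_sobolev_lt_top hΩ_bdd hJ.measurable hC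
      ((div_lt_one hN0).2 hN') hCJ hp hum hu.memW0.eq_zero
      (gagliardo_lt_top hψ hp hψp hu.memW0.memW.energy_lt_top)⟩
  -- Up to the Sobolev exponent of some admissible `α'` only the embedding is needed; letting
  -- `α' → N` this includes every `r` when `α ≥ N`.
  by_cases hle : ∃ α' : ℝ, 0 < α' ∧ α' ≤ α ∧ α' < N ∧ r ≤ p / (1 - α' / N)
  · obtain ⟨α', h0, hα', hN', hr'⟩ := hle
    have : IsFiniteMeasure (volume.restrict Ω) :=
      isFiniteMeasure_restrict.2 hΩ_bdd.measure_lt_top.ne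
    exact (memLp_of_lintegral_abs_rpow_lt_top (hr0.trans_le hr') hum
      (hsob α' h0 hα' hN').2).restrict Ω |>.mono_exponent (ENNReal.ofReal_le_ofReal hr')
  push Not at hle
  have hαN : α < N := by
    by_contra! hNα
    set δ : ℝ := min (N / 2) (p * N / r) with hδ
    have hδ0 : 0 < δ := by positivity
    have hδN : δ ≤ N / 2 := min_le_left _ _
    have hδr : δ ≤ p * N / r := min_le_right _ _
    have h := hle (N - δ) (by linarith) (by linarith) (by linarith)
    have h1 : p / (1 - (N - δ) / N) = p * N / δ := by
      rw [show 1 - (N - δ) / N = δ / N by field_simp; ring, div_div_eq_mul_div]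
    rw [h1, div_lt_iff₀ hδ0] at h
    rw [le_div_iff₀ hr0] at hδr
    linarith
  obtain ⟨⟨C, hC, hCJ⟩, hsobα⟩ := hsob α hα le_rfl hαN
  have hαN' : 0 < (N : ℝ) - α := sub_pos.2 hαN
  have hσ : 1 - α / N = (N - α) / N := by field_simp
  -- The failure of `r ≤ p N / (N - α)` says that `m` exceeds the conjugate of the Sobolev
  -- exponent, which forces `m > 1` and lets `|u| ^ b u` with `b ≥ 0` be tested.
  have hkey : p * N < m * ((p - 1) * N + α) := by
    have h := hle α hα le_rfl hαN
    rw [hσ, div_div_eq_mul_div, hr, div_lt_div_iff₀ hαN' hden] at h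
    have h' : 0 < N * (m * ((p - 1) * N + α) - p * N) := by linarith
    linarith [(mul_pos_iff_of_pos_left hN0).1 h']
  have hm1 : 1 < m := by
    by_contra! h
    have : m * ((p - 1) * N + α) ≤ 1 * ((p - 1) * N + α) := by gcongr
    linarith
  have hm1' : 0 < m - 1 := by linarith
  have hconj := Real.HolderConjugate.conjExponent hm1
  have hm' : m.conjExponent = m / (m - 1) := rfl
  -- `b` solves `(p + b) N / (N - α) = (1 + b) m'`, and both sides are then equal to `r`.
  set b := (p - 1) * N * (m - 1) / (N - m * α) - 1 with hb
  have hb0 : 0 ≤ b := by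
    rw [hb, sub_nonneg, one_le_div hden]
    linarith
  have hrb : (p + b) * (1 / (1 - α / N)) = r := by
    rw [hσ, hb, hr]
    field_simp
    ring
  have hlt := lintegral_lt_top_of_test hJ hψ hp hψp hC ((div_lt_one hN0).2 hαN) hCJ hconj
    (by
      rw [hσ, hm', one_div_div, div_lt_div_iff₀ hm hN0]
      linarith)
    hf hu hsobα hb0
    (by
      rw [hrb, hr, hb, hm']
      field_simp
      ring)
  rw [hrb] at hlt
  exact (memLp_of_lintegral_abs_rpow_lt_top hr0 hum hlt).restrict Ω
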